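/- Let $T=\mathbb{R}/2\pi\mathbb{Z}$ and let $C(T)$ be the space of continuous complex-valued functions on $T$ with the norm $\|f\|=\max_{x\in T}|f(x)|$. For $f\in C(T)$, integers $m\ge 0$ and real $h$ and $\delta>0$, put $$\Delta_h^m f(x)=\sum_{i=0}^m(-1)^{m-i}\binom mi f\Bigl(x-\frac m2h+ih\Bigr),\qquad \omega_m(f,\delta)=\sup_{x\in T,\ |h|<\delta}|\Delta_h^m f(x)|,$$ and let $\alpha=2^{-5/2}\,3^{1/2}\,\pi$. Let $k\ge 0$ and $n\ge 1$ be integers with $n\ge 2k$, and let $f\in C(T)$ have no spectrum in $[-n,n]$, i.e. $\int_T f(u)e^{-iju}\,du=0$ for all integers $j$ with $|j|\le n$. Then $$\|f\|\le\frac{k+1}{\binom{2k}{k}}\;\omega_{2k}\Bigl(f,\frac{2\pi}{n}\,\alpha\Bigr).$$ -/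

import Mathlib

open scoped Real

noncomputable section

namespace BohrFavard

/-- The circle `T = ℝ / 2πℤ`. -/
abbrev T : Type := AddCircle (2 * π)

instance instTwoPiPos : Fact (0 < 2 * π) := ⟨Real.two_pi_pos⟩

/-- The class of continuous functions on the circle without spectrum in `[-n, n]`: all
Fourier coefficients of index `j` with `|j| ≤ n` vanish. The functions are complex-valued; the
real-valued ones are among them. -/
def NoSpectrum (n : ℕ) : Set C(T, ℂ) :=
  {f | ∀ j : ℤ, |j| ≤ (n : ℤ) → fourierCoeff (T := 2 * π) (f : T → ℂ) j = 0}

/-- The symmetric `m`-th difference with step `h`,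
`Δ_h^m f(x) = ∑_{i=0}^m (-1)^{m-i} (m choose i) f(x - (m/2) h + i h)`. -/
def centralDiff (m : ℕ) (h : ℝ) (f : C(T, ℂ)) (x : T) : ℂ :=
  ∑ i ∈ Finset.range (m + 1),
    (-1 : ℂ) ^ (m - i) * (m.choose i : ℂ) * f (x + ((-((m : ℝ) / 2) * h + (i : ℝ) * h : ℝ) : T))

/-- The values over which the supremum in the modulus of smoothness is taken. -/
def modulusSet (m : ℕ) (f : C(T, ℂ)) (δ : ℝ) : Set ℝ :=
  {r | ∃ (x : T) (h : ℝ), |h| < δ ∧ r = ‖centralDiff m h f x‖}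

/-- The `m`-th modulus of smoothness `ω_m(f, δ) = sup_{x, |h| < δ} |Δ_h^m f(x)|`. -/
def modulus (m : ℕ) (f : C(T, ℂ)) (δ : ℝ) : ℝ := sSup (modulusSet m f δ)

/-- The supremum in the modulus of smoothness is over a bounded set. -/
theorem bddAbove_modulusSet (m : ℕ) (f : C(T, ℂ)) (δ : ℝ) : BddAbove (modulusSet m f δ) := by
  refine ⟨∑ i ∈ Finset.range (m + 1), (m.choose i : ℝ) * ‖f‖, ?_⟩
  rintro r ⟨x, h, -, rfl⟩
  refine (norm_sum_le _ _).trans (Finset.sum_le_sum fun i _ => ?_)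
  rw [norm_mul, norm_mul, norm_pow, norm_neg, norm_one, one_pow, one_mul, Complex.norm_natCast]
  exact mul_le_mul_of_nonneg_left (f.norm_coe_le_norm _) (Nat.cast_nonneg _)

/-- For positive `δ` the supremum in the modulus of smoothness is over a nonempty set. -/
theorem modulusSet_nonempty (m : ℕ) (f : C(T, ℂ)) {δ : ℝ} (hδ : 0 < δ) :
    (modulusSet m f δ).Nonempty :=
  ⟨_, 0, 0, by simpa using hδ, rfl⟩

/-- The constant `α = 2^{-5/2} 3^{1/2} π`. -/
def alpha : ℝ := (2 : ℝ) ^ (-(5 / 2) : ℝ) * (3 : ℝ) ^ (1 / 2 : ℝ) * π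

end BohrFavard

end

/-! Average the even central difference at a point over steps `±h`, `0 ≤ h ≤ δ`, with weight `δ -
h`. The middle term gives `(2k choose k) δ² f(x)`, and the whole average is at most `δ² ω_{2k}(f,
δ)`. It remains to see that the other terms are small.

The average at scale `l = i - k ≠ 0` is, up to sign, `l⁻²` times a second difference of the second
primitive of `f`. With no spectrum in `[-n, n]`, that primitive is at most `9/(4n²) ‖f‖`: on the
remaining frequencies `m⁻²` is a combination of three shifted sequences `(|m - N| + a)⁻²`. Each is
convex away from its peak, hence the Fourier coefficients of a modulated nonnegative kernel, with
multiplier norm at most `a⁻²` (`exists_hasSum_invSq_multiplier`).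

The off-centre binomials are at most `k/(k+1)` times the central one (`choose_two_mul_le`), and `∑
(i - k)⁻² ≤ 4`. So the other terms total at most `k/(k+1) (2k choose k) · 36/n² ‖f‖`. Since `36/n² ≤
δ²` for `δ = 2πα/n` (`le_step_sq`), a share `1/(k+1)` of the main term survives, which is the claim.
-/

noncomputable section
namespace BohrFavard

open MeasureTheory AddCircle

/-! ### Convex sequences and nonnegative cosine series -/

/-- The even sequence `l ↦ (|l| + a)⁻²`, convex and decreasing on the natural numbers. -/
def invSq (a : ℝ) (l : ℤ) : ℝ := 1 / (|(l : ℝ)| + a) ^ 2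

theorem invSq_nonneg (a : ℝ) (l : ℤ) : 0 ≤ invSq a l := by unfold invSq; positivity

theorem invSq_neg (a : ℝ) (l : ℤ) : invSq a (-l) = invSq a l := by simp [invSq]

theorem summable_one_div_int_sq : Summable fun l : ℤ => 1 / (l : ℝ) ^ 2 :=
  Real.summable_one_div_int_pow.mpr one_lt_two

theorem summable_invSq {a : ℝ} (ha : 0 < a) : Summable (invSq a) := by
  refine Summable.of_norm_bounded_eventually summable_one_div_int_sq ?_
  have h : {(0 : ℤ)}ᶜ ∈ Filter.cofinite (α := ℤ) := (Set.finite_singleton 0).compl_mem_cofinite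
  filter_upwards [h] with l hl
  have h0 : 0 < |(l : ℝ)| := abs_pos.mpr (by exact_mod_cast hl)
  rw [Real.norm_of_nonneg (invSq_nonneg a l), invSq, ← sq_abs (l : ℝ)]
  gcongr
  linarith

theorem one_div_sq_convex {y : ℝ} (hy : 1 < y) :
    2 * (1 / y ^ 2) ≤ 1 / (y - 1) ^ 2 + 1 / (y + 1) ^ 2 := by
  have h1 : 0 < y - 1 := by linarith
  have h2 : 0 < y + 1 := by linarith
  have h3 : 0 < y := by linarith
  have h4 : 1 / y ^ 2 ≤ 1 / ((y - 1) * (y + 1)) := by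
    apply one_div_le_one_div_of_le (by positivity); nlinarith
  have h5 : 1 / (y - 1) ^ 2 + 1 / (y + 1) ^ 2 - 2 * (1 / ((y - 1) * (y + 1)))
      = (1 / (y - 1) - 1 / (y + 1)) ^ 2 := by
    field_simp
    ring
  nlinarith [sq_nonneg (1 / (y - 1) - 1 / (y + 1))]

theorem invSq_convex_of_pos {a : ℝ} (ha : 0 < a) {l : ℤ} (hl : 0 < l) :
    2 * invSq a l ≤ invSq a (l - 1) + invSq a (l + 1) := by
  have h1 : (1 : ℝ) ≤ l := by exact_mod_cast hl
  have := one_div_sq_convex (y := l + a) (by linarith)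
  simp only [invSq]
  push_cast
  rw [abs_of_nonneg (by linarith : (0 : ℝ) ≤ l), abs_of_nonneg (by linarith : (0 : ℝ) ≤ l - 1),
    abs_of_nonneg (by linarith : (0 : ℝ) ≤ (l : ℝ) + 1)]
  convert this using 4 <;> ring

/-- Convexity fails at the peak `l = 0`, hence the exclusion. -/
theorem invSq_convex {a : ℝ} (ha : 0 < a) {l : ℤ} (hl : l ≠ 0) :
    2 * invSq a l ≤ invSq a (l - 1) + invSq a (l + 1) := by
  rcases hl.lt_or_gt with h | h
  · have := invSq_convex_of_pos ha (l := -l) (by omega)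
    rw [invSq_neg, ← invSq_neg a (-l - 1), ← invSq_neg a (-l + 1)] at this
    rw [show l - 1 = -(-l + 1) by ring, show l + 1 = -(-l - 1) by ring]
    linarith
  · exact invSq_convex_of_pos ha h

theorem summable_invSq_mul_cos {a : ℝ} (ha : 0 < a) (θ : ℝ) :
    Summable fun l : ℤ => invSq a l * Real.cos (l * θ) := by
  refine Summable.of_norm_bounded (summable_invSq ha) fun l => ?_
  rw [norm_mul, Real.norm_of_nonneg (invSq_nonneg a l)]
  exact mul_le_of_le_one_right (invSq_nonneg a l) (Real.abs_cos_le_one _)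

theorem summable_invSq_mul_sin {a : ℝ} (ha : 0 < a) (θ : ℝ) :
    Summable fun l : ℤ => invSq a l * Real.sin (l * θ) := by
  refine Summable.of_norm_bounded (summable_invSq ha) fun l => ?_
  rw [norm_mul, Real.norm_of_nonneg (invSq_nonneg a l)]
  exact mul_le_of_le_one_right (invSq_nonneg a l) (Real.abs_sin_le_one _)

/-- The cosine series with the convex coefficients `invSq a` is nonnegative. -/
theorem tsum_invSq_mul_cos_nonneg {a : ℝ} (ha : 0 < a) (θ : ℝ) :
    0 ≤ ∑' l : ℤ, invSq a l * Real.cos (l * θ) := by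
  set g := ∑' l : ℤ, invSq a l * Real.cos (l * θ) with hg
  have hs : HasSum (fun l : ℤ => invSq a l * Real.cos (l * θ)) g :=
    (summable_invSq_mul_cos ha θ).hasSum
  have hq : HasSum (invSq a) (∑' l, invSq a l) := (summable_invSq ha).hasSum
  have shift : ∀ {u : ℤ → ℝ} {s : ℝ}, HasSum u s → ∀ c : ℤ, HasSum (fun l => u (l + c)) s :=
    fun h c => (Equiv.addRight c).hasSum_iff.mpr h
  have hq1 := shift hq 1
  have hq2 := shift hq (-1)
  have s1 : HasSum (fun l : ℤ => invSq a (l + 1) * Real.cos (l * θ)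
      + invSq a (l - 1) * Real.cos (l * θ)) (2 * Real.cos θ * g) := by
    have hS := ((summable_invSq_mul_sin ha θ).hasSum.mul_right (Real.sin θ))
    have hC := hs.mul_right (Real.cos θ)
    -- The addition formulas turn the two shifted series into the required one; the unknown sine sum
    -- enters with opposite signs and cancels.
    have e := (shift (hC.add hS) 1).add (shift (hC.sub hS) (-1))
    rw [show ∀ c s : ℝ, g * c + s + (g * c - s) = 2 * c * g by intros; ring] at e
    refine (congrArg (HasSum · _) (funext fun l => ?_)).mp e
    have c1 : Real.cos (l * θ) = Real.cos ((l + 1) * θ) * Real.cos θ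
        + Real.sin ((l + 1) * θ) * Real.sin θ := by
      rw [← Real.cos_sub]; ring_nf
    have c2 : Real.cos (l * θ) = Real.cos ((l - 1) * θ) * Real.cos θ
        - Real.sin ((l - 1) * θ) * Real.sin θ := by
      rw [← Real.cos_add]; ring_nf
    have c3 : l + -1 = l - 1 := rfl
    rw [c3]
    push_cast
    nth_rewrite 1 [c1]
    rw [c2]
    ring
  have s2 : HasSum (fun l : ℤ => (invSq a (l + 1) + invSq a (l - 1) - 2 * invSq a l)
      * (1 - Real.cos (l * θ))) ((2 - 2 * Real.cos θ) * g) := by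
    have := ((hq1.add hq2).sub (hq.mul_left 2)).sub (s1.sub (hs.mul_left 2))
    rw [show ∀ q : ℝ, q + q - 2 * q - (2 * Real.cos θ * g - 2 * g) = (2 - 2 * Real.cos θ) * g by
      intros; ring] at this
    refine (congrArg (HasSum · _) (funext fun l => ?_)).mp this
    rw [show l + -1 = l - 1 from rfl]
    ring
  -- Summation by parts has moved the second difference onto the coefficients. At `l = 0`, where it
  -- is negative, the factor `1 - cos 0` vanishes.
  have h3 : 0 ≤ (2 - 2 * Real.cos θ) * g := by
    refine s2.nonneg fun l => ?_
    rcases eq_or_ne l 0 with rfl | hl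
    · simp
    · exact mul_nonneg (by linarith [invSq_convex ha hl]) (by linarith [Real.cos_le_one (l * θ)])
  rcases (Real.cos_le_one θ).lt_or_eq with h | h
  · exact nonneg_of_mul_nonneg_right h3 (by linarith)
  · obtain ⟨m, rfl⟩ := (Real.cos_eq_one_iff θ).mp h
    refine tsum_nonneg fun l => mul_nonneg (invSq_nonneg a l) ?_
    rw [show (l : ℝ) * (m * (2 * π)) = ((l * m : ℤ) : ℝ) * (2 * π) by push_cast; ring,
      Real.cos_int_mul_two_pi]
    exact zero_le_one

/-! ### The nonnegative kernel and its multipliers -/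

/-- The kernel with Fourier coefficients `(|l| + a)⁻²`. -/
def convexKernel (a : ℝ) (t : T) : ℂ := ∑' l : ℤ, (invSq a l : ℂ) * fourier l t

theorem fourier_two_pi_coe (l : ℤ) (θ : ℝ) :
    fourier l (θ : T) = Complex.exp ((l * θ : ℝ) * Complex.I) := by
  rw [fourier_coe_apply]
  congr 1
  have : (π : ℂ) ≠ 0 := by exact_mod_cast Real.pi_ne_zero
  push_cast
  field_simp

theorem norm_fourier_apply (l : ℤ) (t : T) : ‖fourier l t‖ = 1 := Circle.norm_coe _

theorem summable_convexKernel {a : ℝ} (ha : 0 < a) (t : T) :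
    Summable fun l : ℤ => (invSq a l : ℂ) * fourier l t := by
  refine Summable.of_norm_bounded (summable_invSq ha) fun l => ?_
  rw [norm_mul, norm_fourier_apply, mul_one, Complex.norm_real,
    Real.norm_of_nonneg (invSq_nonneg a l)]

theorem convexKernel_coe {a : ℝ} (ha : 0 < a) (θ : ℝ) :
    convexKernel a (θ : T) = ((∑' l : ℤ, invSq a l * Real.cos (l * θ) : ℝ) : ℂ) := by
  have h := (summable_convexKernel ha (θ : T)).hasSum
  apply Complex.ext
  · rw [Complex.ofReal_re]
    refine (Complex.hasSum_re h).unique ?_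
    convert (summable_invSq_mul_cos ha θ).hasSum using 2 with l
    rw [fourier_two_pi_coe, Complex.re_ofReal_mul, Complex.exp_ofReal_mul_I_re]
  · rw [Complex.ofReal_im]
    have h1 := Complex.hasSum_im h
    have h2 := (Equiv.neg ℤ).hasSum_iff.mpr h1
    have h3 : (convexKernel a (θ : T)).im = -(convexKernel a (θ : T)).im := by
      refine h2.unique ?_
      refine (congrArg (HasSum · _) (funext fun l => ?_)).mp h1.neg
      symm
      change ((invSq a (-l) : ℂ) * fourier (-l) (θ : T)).im = _
      rw [fourier_two_pi_coe, fourier_two_pi_coe, Complex.im_ofReal_mul, Complex.im_ofReal_mul,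
        Complex.exp_ofReal_mul_I_im, Complex.exp_ofReal_mul_I_im, invSq_neg]
      simp
    linarith

theorem norm_convexKernel {a : ℝ} (ha : 0 < a) (t : T) :
    (‖convexKernel a t‖ : ℂ) = convexKernel a t := by
  induction t using QuotientAddGroup.induction_on with
  | H θ =>
    rw [convexKernel_coe ha, Complex.norm_real,
      Real.norm_of_nonneg (tsum_invSq_mul_cos_nonneg ha θ)]

theorem continuous_convexKernel {a : ℝ} (ha : 0 < a) : Continuous (convexKernel a) := by
  refine continuous_tsum (fun l => by fun_prop) (summable_invSq ha) fun l t => ?_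
  rw [norm_mul, norm_fourier_apply, mul_one, Complex.norm_real,
    Real.norm_of_nonneg (invSq_nonneg a l)]

theorem integral_fourier_eq (m : ℤ) :
    ∫ t : T, fourier m t ∂haarAddCircle = if m = 0 then 1 else 0 := by
  split_ifs with h
  · subst h; simp
  · exact integral_eq_zero_of_add_right_eq_neg (fourier_add_half_inv_index h Real.two_pi_pos)

theorem integrable_of_continuous {g : T → ℂ} (hg : Continuous g) : Integrable g haarAddCircle :=
  hg.integrable_of_hasCompactSupport (HasCompactSupport.of_compactSpace g)

/-- Integrating a continuous function against the modulated kernel termwise. -/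
theorem hasSum_integral_convexKernel {a : ℝ} (ha : 0 < a) {g : T → ℂ} (hg : Continuous g) :
    HasSum (fun l : ℤ => (invSq a l : ℂ) * ∫ t, g t * fourier l t ∂haarAddCircle)
      (∫ t, g t * convexKernel a t ∂haarAddCircle) := by
  obtain ⟨C, hC⟩ := isCompact_univ.exists_bound_of_continuousOn hg.continuousOn
  have := hasSum_integral_of_summable_integral_norm (μ := (haarAddCircle : Measure T))
    (F := fun (l : ℤ) t => (invSq a l : ℂ) * (g t * fourier l t))
    (fun l => integrable_of_continuous (by fun_prop)) (by
      refine Summable.of_norm_bounded ((summable_invSq ha).mul_right C) fun l => ?_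
      rw [Real.norm_of_nonneg (integral_nonneg fun t => norm_nonneg _)]
      refine (integral_mono_of_nonneg (Filter.Eventually.of_forall fun t => norm_nonneg _)
        (integrable_const (invSq a l * C)) (Filter.Eventually.of_forall fun t => ?_)).trans ?_
      · simp only [norm_mul, norm_fourier_apply, mul_one, Complex.norm_real,
          Real.norm_of_nonneg (invSq_nonneg a l)]
        exact mul_le_mul_of_nonneg_left (hC t trivial) (invSq_nonneg a l)
      · simp)
  simp only [integral_const_mul] at this
  have e : ∀ t, ∑' l : ℤ, (invSq a l : ℂ) * (g t * fourier l t) = g t * convexKernel a t := by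
    intro t
    rw [convexKernel, ← tsum_mul_left]
    exact tsum_congr fun l => by ring
  simpa only [e] using this

/-- By nonnegativity the L¹ norm is the zeroth Fourier coefficient. -/
theorem integral_norm_convexKernel {a : ℝ} (ha : 0 < a) :
    ∫ t, ‖convexKernel a t‖ ∂haarAddCircle = 1 / a ^ 2 := by
  have h := hasSum_integral_convexKernel ha (g := fun _ => 1) continuous_const
  simp only [one_mul, integral_fourier_eq] at h
  have h1 := h.unique (hasSum_single 0 fun l hl => by simp [hl])
  have h2 : ((∫ t, ‖convexKernel a t‖ ∂haarAddCircle : ℝ) : ℂ) = ((1 / a ^ 2 : ℝ) : ℂ) := by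
    rw [← integral_complex_ofReal]
    simp only [norm_convexKernel ha, h1]
    simp [invSq]
  exact_mod_cast h2

theorem integral_translate_mul_fourier (f : C(T, ℂ)) (x : T) (m : ℤ) :
    ∫ t, f (x - t) * fourier m t ∂haarAddCircle = fourierCoeff f m * fourier m x := by
  rw [← integral_sub_left_eq_self (fun t => f (x - t) * fourier m t) haarAddCircle x,
    fourierCoeff, ← integral_mul_const]
  congr 1
  ext t
  rw [sub_sub_cancel, sub_eq_add_neg, smul_eq_mul]
  have : fourier m (x + -t) = fourier m x * fourier (-m) t := by
    simp only [fourier_apply, smul_add, toCircle_add, smul_neg, neg_smul, Circle.coe_mul]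
  rw [this]; ring

/-- The multiplier `(|m - N| + a)⁻²` has norm at most `a⁻²` on continuous functions. -/
theorem exists_hasSum_invSq_multiplier {a : ℝ} (ha : 0 < a) (N : ℤ) (f : C(T, ℂ)) (x : T) :
    ∃ s : ℂ, ‖s‖ ≤ 1 / a ^ 2 * ‖f‖ ∧
      HasSum (fun m : ℤ => (invSq a (m - N) : ℂ) * (fourierCoeff f m * fourier m x)) s := by
  -- Modulation by `fourier N` moves the peak of the multiplier from `0` to `N`.
  have hg : Continuous fun t => f (x - t) * fourier N t := by fun_prop
  refine ⟨∫ t, f (x - t) * fourier N t * convexKernel a t ∂haarAddCircle, ?_, ?_⟩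
  · rw [← integral_norm_convexKernel ha, ← integral_mul_const]
    refine norm_integral_le_of_norm_le
      (((integrable_of_continuous (continuous_convexKernel ha)).norm).mul_const _)
      (Filter.Eventually.of_forall fun t => ?_)
    rw [norm_mul, norm_mul, norm_fourier_apply, mul_one, mul_comm]
    exact mul_le_mul_of_nonneg_left (f.norm_coe_le_norm _) (norm_nonneg _)
  · rw [← (Equiv.addRight N).hasSum_iff]
    convert hasSum_integral_convexKernel ha hg using 2 with l
    simp only [Function.comp, Equiv.coe_addRight, add_sub_cancel_right]
    rw [← integral_translate_mul_fourier]
    congr 2 with t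
    rw [add_comm l N, fourier_add, mul_assoc]

/-! ### The second primitive -/

/-- The second primitive (up to sign) of the mean-zero part of `f`, as a Fourier series. -/
def secondPrimitive (f : C(T, ℂ)) (x : T) : ℂ :=
  ∑' m : ℤ, ((1 / (m : ℝ) ^ 2 : ℝ) : ℂ) * (fourierCoeff f m * fourier m x)

theorem norm_fourierCoeff_le (f : C(T, ℂ)) (m : ℤ) : ‖fourierCoeff f m‖ ≤ ‖f‖ := by
  refine (norm_integral_le_of_norm_le (integrable_const ‖f‖)
    (Filter.Eventually.of_forall fun t => ?_)).trans (by simp)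
  rw [norm_smul, norm_fourier_apply, one_mul]
  exact f.norm_coe_le_norm t

theorem hasSum_secondPrimitive (f : C(T, ℂ)) (x : T) :
    HasSum (fun m : ℤ => ((1 / (m : ℝ) ^ 2 : ℝ) : ℂ) * (fourierCoeff f m * fourier m x))
      (secondPrimitive f x) := by
  refine (Summable.of_norm_bounded (summable_one_div_int_sq.mul_right ‖f‖) fun m => ?_).hasSum
  rw [norm_mul, norm_mul, norm_fourier_apply, mul_one, Complex.norm_real,
    Real.norm_of_nonneg (by positivity)]
  exact mul_le_mul_of_nonneg_left (norm_fourierCoeff_le f m) (by positivity)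

/-- Of the two sequences peaked at `±n`, one equals `m⁻²` and the other `(|m| + 2n)⁻²`; the third
removes the latter. -/
theorem invSq_combination {n m : ℤ} (hn : 0 < n) (hm : n < |m|) :
    invSq n (m - n) + invSq n (m + n) - invSq (2 * n) m = 1 / (m : ℝ) ^ 2 := by
  have hn' : (0 : ℝ) < n := by exact_mod_cast hn
  simp only [invSq]
  push_cast
  rcases lt_abs.mp hm with h | h
  · have h' : (n : ℝ) < m := by exact_mod_cast h
    rw [abs_of_pos (by linarith), abs_of_pos (by linarith), abs_of_pos (by linarith)]
    ring_nf
  · have h' : (n : ℝ) < -m := by exact_mod_cast h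
    rw [abs_of_neg (by linarith), abs_of_neg (by linarith), abs_of_neg (by linarith)]
    ring_nf

/-- A second-order Bohr–Favard inequality with a non-sharp constant. -/
theorem norm_secondPrimitive_le {n : ℕ} (hn : 0 < n) {f : C(T, ℂ)} (hf : f ∈ NoSpectrum n)
    (x : T) : ‖secondPrimitive f x‖ ≤ 9 / (4 * (n : ℝ) ^ 2) * ‖f‖ := by
  have hn' : (0 : ℝ) < n := by exact_mod_cast hn
  obtain ⟨s₁, b₁, h₁⟩ := exists_hasSum_invSq_multiplier hn' n f x
  obtain ⟨s₂, b₂, h₂⟩ := exists_hasSum_invSq_multiplier hn' (-n) f x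
  obtain ⟨s₃, b₃, h₃⟩ := exists_hasSum_invSq_multiplier (a := 2 * n) (by positivity) 0 f x
  have key : secondPrimitive f x = s₁ + s₂ - s₃ := by
    refine (hasSum_secondPrimitive f x).unique
      ((congrArg (HasSum · _) (funext fun m => ?_)).mp ((h₁.add h₂).sub h₃))
    by_cases hm : |m| ≤ (n : ℤ)
    · simp [hf m hm]
    · have := invSq_combination (n := n) (by exact_mod_cast hn) (not_le.mp hm)
      rw [Int.cast_natCast] at this
      rw [← this, sub_neg_eq_add, sub_zero]
      push_cast
      ring
  rw [key]
  calc ‖s₁ + s₂ - s₃‖ ≤ ‖s₁‖ + ‖s₂‖ + ‖s₃‖ :=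
        (norm_sub_le _ _).trans (by gcongr; exact norm_add_le _ _)
    _ ≤ 1 / (n : ℝ) ^ 2 * ‖f‖ + 1 / (n : ℝ) ^ 2 * ‖f‖ + 1 / (2 * (n : ℝ)) ^ 2 * ‖f‖ := by gcongr
    _ = _ := by field_simp; ring

/-! ### Triangular averages as second differences -/

/-- The average of `f` over `x ± h`, `0 ≤ h ≤ δ`, at scale `l`, with triangular weight. -/
def hatAverage (l : ℤ) (δ : ℝ) (x : T) (f : C(T, ℂ)) : ℂ :=
  ∫ h in (0 : ℝ)..δ, ((δ - h : ℝ) : ℂ) *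
    (f (x + ((l * h : ℝ) : T)) + f (x - ((l * h : ℝ) : T)))

theorem continuous_hatAverage_integrand (l : ℤ) (δ : ℝ) (x : T) (f : C(T, ℂ)) :
    Continuous fun h : ℝ => ((δ - h : ℝ) : ℂ) *
      (f (x + ((l * h : ℝ) : T)) + f (x - ((l * h : ℝ) : T))) := by
  have : Continuous fun h : ℝ => ((l * h : ℝ) : T) :=
    (AddCircle.continuous_mk' (2 * π)).comp (by fun_prop)
  fun_prop

theorem integral_sub_mul {δ : ℝ} (C : ℝ) : ∫ h in (0 : ℝ)..δ, (δ - h) * C = δ ^ 2 / 2 * C := by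
  rw [intervalIntegral.integral_mul_const, intervalIntegral.integral_sub (by simp) (by simp),
    intervalIntegral.integral_const, integral_id, smul_eq_mul]
  ring

theorem norm_integral_sub_mul_le {δ : ℝ} (hδ : 0 ≤ δ) {C : ℝ} {u : ℝ → ℂ}
    (hu : ∀ h, 0 < h → h < δ → ‖u h‖ ≤ C) :
    ‖∫ h in (0 : ℝ)..δ, ((δ - h : ℝ) : ℂ) * u h‖ ≤ δ ^ 2 / 2 * C := by
  rw [← integral_sub_mul]
  refine intervalIntegral.norm_integral_le_of_norm_le hδ
    (Filter.Eventually.of_forall fun h hh => ?_)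
    (Continuous.intervalIntegrable (by fun_prop) _ _)
  rw [norm_mul, Complex.norm_real, Real.norm_of_nonneg (by linarith [hh.2])]
  -- The endpoint `h = δ`, excluded by the strict bound in the modulus, has weight zero.
  rcases hh.2.lt_or_eq with h1 | h1
  · exact mul_le_mul_of_nonneg_left (hu h hh.1 h1) (by linarith)
  · simp [h1]

theorem hatAverage_zero (δ : ℝ) (x : T) (f : C(T, ℂ)) :
    hatAverage 0 δ x f = (δ : ℂ) ^ 2 * f x := by
  have h := integral_sub_mul (δ := δ) 2
  simp only [hatAverage, Int.cast_zero, zero_mul, AddCircle.coe_zero, add_zero, sub_zero, ← two_mul]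
  simp_rw [← mul_assoc]
  rw [intervalIntegral.integral_mul_const]
  congr 1
  have h2 := congrArg (Complex.ofReal) h
  rw [← intervalIntegral.integral_ofReal] at h2
  push_cast at h2 ⊢
  rw [h2]
  ring

/-- `hatAverage` as a continuous linear functional. -/
def hatAverageCLM (l : ℤ) {δ : ℝ} (hδ : 0 ≤ δ) (x : T) : C(T, ℂ) →L[ℂ] ℂ :=
  LinearMap.mkContinuous
    { toFun := hatAverage l δ x
      map_add' := fun f g => by
        rw [hatAverage, hatAverage, hatAverage, ← intervalIntegral.integral_add
          ((continuous_hatAverage_integrand l δ x f).intervalIntegrable _ _)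
          ((continuous_hatAverage_integrand l δ x g).intervalIntegrable _ _)]
        congr 1
        ext h
        simp only [ContinuousMap.add_apply]
        ring
      map_smul' := fun c f => by
        rw [hatAverage, hatAverage, RingHom.id_apply, smul_eq_mul,
          ← intervalIntegral.integral_const_mul]
        congr 1
        ext h
        simp only [ContinuousMap.smul_apply, smul_eq_mul]
        ring }
    (δ ^ 2) fun f => by
      refine (norm_integral_sub_mul_le hδ (C := 2 * ‖f‖) fun h _ _ => ?_).trans (le_of_eq (by ring))
      exact (norm_add_le _ _).trans ((add_le_add (f.norm_coe_le_norm _)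
        (f.norm_coe_le_norm _)).trans_eq (two_mul _).symm)

/-- The Fourier coefficient as a continuous linear functional. -/
def fourierCoeffCLM (m : ℤ) : C(T, ℂ) →L[ℂ] ℂ :=
  LinearMap.mkContinuous
    { toFun := fun f => fourierCoeff f m
      map_add' := fun f g => by
        have := fourierCoeff.add (integrable_of_continuous f.continuous)
          (integrable_of_continuous g.continuous)
        exact congrFun this m
      map_smul' := fun c f => fourierCoeff.const_smul f c m }
    1 fun f => by rw [one_mul]; exact norm_fourierCoeff_le f m

theorem fourierCoeff_fourier_eq (m j : ℤ) :
    fourierCoeff (fourier j : C(T, ℂ)) m = if m = j then 1 else 0 := by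
  have : ∀ t : T, fourier (-m) t • fourier j t = fourier (j - m) t := fun t => by
    rw [smul_eq_mul, ← fourier_add]; congr 2; ring
  simp only [fourierCoeff, this, integral_fourier_eq, sub_eq_zero, eq_comm]

theorem integral_sub_mul_cos {b : ℝ} (hb : b ≠ 0) (δ : ℝ) :
    ∫ h in (0 : ℝ)..δ, (δ - h) * (2 * Real.cos (b * h)) = 2 * (1 - Real.cos (b * δ)) / b ^ 2 := by
  have hd : ∀ h : ℝ, HasDerivAt
      (fun h => (δ - h) * (2 * Real.sin (b * h) / b) - 2 * Real.cos (b * h) / b ^ 2)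
      ((δ - h) * (2 * Real.cos (b * h))) h := fun h => by
    have hlin : HasDerivAt (fun h : ℝ => b * h) b h := by
      simpa using (hasDerivAt_id h).const_mul b
    have h1 := ((hlin.sin.const_mul 2).div_const b)
    have h2 := ((hlin.cos.const_mul 2).div_const (b ^ 2))
    refine ((((hasDerivAt_id h).const_sub δ).mul h1).sub h2).congr_deriv ?_
    simp only [id]
    field_simp
    ring
  rw [intervalIntegral.integral_eq_sub_of_hasDerivAt (fun h _ => hd h)
    (Continuous.intervalIntegrable (by fun_prop) _ _)]
  simp
  ring

theorem fourier_add_apply (m : ℤ) (x y : T) : fourier m (x + y) = fourier m x * fourier m y := by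
  simp only [fourier_apply, smul_add, toCircle_add, Circle.coe_mul]

theorem fourier_add_add_fourier_sub (m : ℤ) (x : T) (y : ℝ) :
    fourier m (x + (y : T)) + fourier m (x - (y : T))
      = fourier m x * ((2 * Real.cos (m * y) : ℝ) : ℂ) := by
  rw [sub_eq_add_neg, ← AddCircle.coe_neg, fourier_add_apply, fourier_add_apply,
    fourier_two_pi_coe, fourier_two_pi_coe, ← mul_add]
  congr 1
  push_cast
  rw [Complex.two_cos, mul_neg, neg_mul]

theorem hatAverage_fourier {l : ℤ} (hl : l ≠ 0) (δ : ℝ) (x : T) {m : ℤ} (hm : m ≠ 0) :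
    hatAverage l δ x (fourier m) = ((1 / (m : ℝ) ^ 2 : ℝ) : ℂ) * ((1 / (l : ℝ) ^ 2 : ℝ) : ℂ) *
      (2 * fourier m x - (fourier m (x + ((l * δ : ℝ) : T)) + fourier m (x - ((l * δ : ℝ) : T)))) := by
  have hl' : (l : ℝ) ≠ 0 := by exact_mod_cast hl
  have hm' : (m : ℝ) ≠ 0 := by exact_mod_cast hm
  have h := integral_sub_mul_cos (mul_ne_zero hm' hl') δ
  have e : ∀ h : ℝ, ((δ - h : ℝ) : ℂ) * (fourier m x * ((2 * Real.cos (m * (l * h)) : ℝ) : ℂ))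
      = fourier m x * (((δ - h) * (2 * Real.cos (m * l * h)) : ℝ) : ℂ) := fun h => by
    rw [← mul_assoc (m : ℝ), Complex.ofReal_mul (δ - h)]; ring
  simp only [hatAverage, fourier_add_add_fourier_sub, e]
  rw [intervalIntegral.integral_const_mul, intervalIntegral.integral_ofReal, h]
  have e2 : 2 * (1 - Real.cos (m * l * δ)) / (m * l : ℝ) ^ 2
      = 1 / (m : ℝ) ^ 2 * (1 / (l : ℝ) ^ 2) * (2 - 2 * Real.cos (m * (l * δ))) := by
    field_simp
  rw [e2]
  simp only [Complex.ofReal_mul, Complex.ofReal_sub, Complex.ofReal_ofNat]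
  ring

/-- The multiplier of `hatAverage`. -/
def hatMultiplier (l : ℤ) (δ : ℝ) (x : T) (m : ℤ) : ℂ :=
  ((1 / (m : ℝ) ^ 2 : ℝ) : ℂ) * ((1 / (l : ℝ) ^ 2 : ℝ) : ℂ) *
      (2 * fourier m x - (fourier m (x + ((l * δ : ℝ) : T)) + fourier m (x - ((l * δ : ℝ) : T))))
    + if m = 0 then (δ : ℂ) ^ 2 else 0

theorem hatAverage_fourier_eq_hatMultiplier {l : ℤ} (hl : l ≠ 0) (δ : ℝ) (x : T) (m : ℤ) :
    hatAverage l δ x (fourier m) = hatMultiplier l δ x m := by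
  unfold hatMultiplier
  split_ifs with hm
  · subst hm
    have h := congrArg Complex.ofReal (integral_sub_mul (δ := δ) 2)
    rw [← intervalIntegral.integral_ofReal] at h
    simp only [hatAverage, fourier_zero]
    push_cast at h ⊢
    rw [one_add_one_eq_two, h]
    simp
  · rw [add_zero, hatAverage_fourier hl δ x hm]

theorem summable_norm_hatMultiplier (l : ℤ) (δ : ℝ) (x : T) :
    Summable fun m => ‖hatMultiplier l δ x m‖ := by
  refine (Summable.add (summable_one_div_int_sq.mul_right (1 / (l : ℝ) ^ 2 * 4))
    (hasSum_ite_eq (0 : ℤ) (δ ^ 2)).summable).of_nonneg_of_le (fun m => norm_nonneg _) fun m => ?_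
  refine (norm_add_le _ _).trans (add_le_add ?_ ?_)
  · rw [norm_mul, norm_mul, Complex.norm_real, Complex.norm_real,
      Real.norm_of_nonneg (by positivity), Real.norm_of_nonneg (by positivity), mul_assoc]
    gcongr
    refine (norm_sub_le _ _).trans ?_
    have := norm_add_le (fourier m (x + ((l * δ : ℝ) : T))) (fourier m (x - ((l * δ : ℝ) : T)))
    rw [norm_fourier_apply, norm_fourier_apply] at this
    rw [norm_mul, norm_fourier_apply, Complex.norm_ofNat]
    linarith
  · split_ifs <;> simp

theorem exists_clm_hasSum_fourierCoeff {c : ℤ → ℂ} (hc : Summable fun m => ‖c m‖) :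
    ∃ L : C(T, ℂ) →L[ℂ] ℂ, ∀ g : C(T, ℂ), HasSum (fun m => c m * fourierCoeff g m) (L g) := by
  have hsum : Summable fun m => c m • fourierCoeffCLM m := by
    refine Summable.of_norm_bounded hc fun m => ?_
    rw [norm_smul]
    exact mul_le_of_le_one_right (norm_nonneg _) (LinearMap.mkContinuous_norm_le _ zero_le_one _)
  obtain ⟨L, hL⟩ := hsum
  exact ⟨L, fun g => hL.mapL (ContinuousLinearMap.apply ℂ ℂ g)⟩

theorem hasSum_mul_fourierCoeff_fourier (c : ℤ → ℂ) (j : ℤ) :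
    HasSum (fun m => c m * fourierCoeff (fourier j : C(T, ℂ)) m) (c j) := by
  have h : (fun m => c m * fourierCoeff (fourier j : C(T, ℂ)) m)
      = fun m => if m = j then c j else 0 := by
    ext m
    rw [fourierCoeff_fourier_eq]
    split_ifs with hm
    · rw [hm, mul_one]
    · rw [mul_zero]
  rw [h]
  exact hasSum_ite_eq j (c j)

/-- The Fourier series of `f` need not converge, so the identity is checked on monomials and
extended by density: both sides are continuous linear functionals of `f`. -/
theorem hasSum_hatAverage {l : ℤ} (hl : l ≠ 0) {δ : ℝ} (hδ : 0 ≤ δ) (x : T) (f : C(T, ℂ)) :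
    HasSum (fun m => hatMultiplier l δ x m * fourierCoeff f m) (hatAverage l δ x f) := by
  obtain ⟨L, hL⟩ := exists_clm_hasSum_fourierCoeff (summable_norm_hatMultiplier l δ x)
  have heq : hatAverageCLM l hδ x = L := by
    refine ContinuousLinearMap.ext_on (s := Set.range (fourier (T := 2 * π)))
      (Submodule.dense_iff_topologicalClosure_eq_top.mpr span_fourier_closure_eq_top) ?_
    rintro _ ⟨j, rfl⟩
    have h := (hasSum_mul_fourierCoeff_fourier (hatMultiplier l δ x) j).unique (hL (fourier j))
    rw [← h, ← hatAverage_fourier_eq_hatMultiplier hl]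
    rfl
  have h := hL f
  rw [← heq] at h
  exact h

theorem hatAverage_eq_of_fourierCoeff_zero {l : ℤ} (hl : l ≠ 0) {δ : ℝ} (hδ : 0 ≤ δ) (x : T)
    {f : C(T, ℂ)} (hf : fourierCoeff f 0 = 0) :
    hatAverage l δ x f = ((1 / (l : ℝ) ^ 2 : ℝ) : ℂ) * (2 * secondPrimitive f x -
      (secondPrimitive f (x + ((l * δ : ℝ) : T)) + secondPrimitive f (x - ((l * δ : ℝ) : T)))) := by
  refine (hasSum_hatAverage hl hδ x f).unique ?_
  have := (((hasSum_secondPrimitive f x).mul_left 2).sub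
    ((hasSum_secondPrimitive f (x + ((l * δ : ℝ) : T))).add
      (hasSum_secondPrimitive f (x - ((l * δ : ℝ) : T))))).mul_left ((1 / (l : ℝ) ^ 2 : ℝ) : ℂ)
  refine (congrArg (HasSum · _) (funext fun m => ?_)).mp this
  rw [hatMultiplier]
  split_ifs with hm
  -- The extra `δ²` of the multiplier at `m = 0` meets a vanishing coefficient.
  · simp [hm, hf]
  · ring

theorem norm_hatAverage_le {n : ℕ} (hn : 0 < n) {f : C(T, ℂ)} (hf : f ∈ NoSpectrum n)
    {l : ℤ} (hl : l ≠ 0) {δ : ℝ} (hδ : 0 ≤ δ) (x : T) :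
    ‖hatAverage l δ x f‖ ≤ 9 / (n : ℝ) ^ 2 * ‖f‖ * (1 / (l : ℝ) ^ 2) := by
  rw [hatAverage_eq_of_fourierCoeff_zero hl hδ x (hf 0 (by simp)), norm_mul, Complex.norm_real,
    Real.norm_of_nonneg (by positivity), mul_comm]
  gcongr
  have h1 := norm_secondPrimitive_le hn hf x
  have h2 := norm_secondPrimitive_le hn hf (x + ((l * δ : ℝ) : T))
  have h3 := norm_secondPrimitive_le hn hf (x - ((l * δ : ℝ) : T))
  have h4 : 9 / (n : ℝ) ^ 2 * ‖f‖ = 4 * (9 / (4 * (n : ℝ) ^ 2) * ‖f‖) := by field_simp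
  refine (norm_sub_le _ _).trans ?_
  have h5 := norm_add_le (secondPrimitive f (x + ((l * δ : ℝ) : T)))
    (secondPrimitive f (x - ((l * δ : ℝ) : T)))
  rw [norm_mul, Complex.norm_ofNat]
  linarith

/-! ### Numerical estimates -/

/-- Binomials increase up to the middle, and equality holds at `i = k - 1`. -/
theorem choose_two_mul_le_of_lt {k i : ℕ} (hi : i < k) :
    (k + 1) * (2 * k).choose i ≤ k * (2 * k).choose k := by
  obtain ⟨k, rfl⟩ : ∃ j, k = j + 1 := ⟨k - 1, by omega⟩
  have h1 : ∀ j, i ≤ j → j ≤ k → (2 * (k + 1)).choose i ≤ (2 * (k + 1)).choose j := by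
    intro j hj
    induction j, hj using Nat.le_induction with
    | base => exact fun _ => le_rfl
    | succ j _ ih =>
      exact fun hjk => (ih (by omega)).trans (Nat.choose_le_succ_of_lt_half_left (by omega))
  have h2 := Nat.choose_succ_right_eq (2 * (k + 1)) k
  rw [show 2 * (k + 1) - k = k + 1 + 1 by omega] at h2
  have h3 := h1 k (by omega) le_rfl
  nlinarith

theorem choose_two_mul_le {k i : ℕ} (hi : i ≠ k) (hik : i ≤ 2 * k) :
    (k + 1) * (2 * k).choose i ≤ k * (2 * k).choose k := by
  rcases hi.lt_or_gt with h | h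
  · exact choose_two_mul_le_of_lt h
  · rw [← Nat.choose_symm hik]
    exact choose_two_mul_le_of_lt (by omega)

/-- The subtracted term makes the induction telescope: the two new end terms are each at most
`1/(k+1) - 1/(k+2)`. The middle term is `1/0 = 0`. -/
theorem sum_one_div_sub_sq_le_sub (k : ℕ) :
    ∑ i ∈ Finset.range (2 * (k + 1) + 1), 1 / ((i : ℝ) - ((k + 1 : ℕ) : ℝ)) ^ 2
      ≤ 4 - 2 / ((k : ℝ) + 1) := by
  induction k with
  | zero => norm_num [Finset.sum_range_succ]
  | succ k ih =>
    rw [show 2 * (k + 1 + 1) + 1 = 2 * (k + 1) + 1 + 1 + 1 by ring, Finset.sum_range_succ,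
      Finset.sum_range_succ']
    have e : ∀ i : ℕ, 1 / (((i + 1 : ℕ) : ℝ) - ((k + 1 + 1 : ℕ) : ℝ)) ^ 2
        = 1 / ((i : ℝ) - ((k + 1 : ℕ) : ℝ)) ^ 2 := fun i => by push_cast; ring_nf
    rw [Finset.sum_congr rfl fun i _ => e i]
    have hk : (0 : ℝ) ≤ k := Nat.cast_nonneg k
    have h1 : 1 / (((0 : ℕ) : ℝ) - ((k + 1 + 1 : ℕ) : ℝ)) ^ 2 = 1 / ((k : ℝ) + 2) ^ 2 := by
      push_cast; ring_nf
    have h2 : 1 / (((2 * (k + 1) + 1 + 1 : ℕ) : ℝ) - ((k + 1 + 1 : ℕ) : ℝ)) ^ 2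
        = 1 / ((k : ℝ) + 2) ^ 2 := by
      push_cast; ring_nf
    have h3 : 1 / ((k : ℝ) + 2) ^ 2 ≤ 1 / ((k : ℝ) + 1) - 1 / ((k : ℝ) + 2) := by
      rw [div_sub_div _ _ (by positivity) (by positivity)]
      rw [div_le_div_iff₀ (by positivity) (by positivity)]
      nlinarith
    have h4 : 2 / ((k : ℝ) + 1) = 2 * (1 / ((k : ℝ) + 1)) := by ring
    have h5 : 2 / (((k + 1 : ℕ) : ℝ) + 1) = 2 * (1 / ((k : ℝ) + 2)) := by push_cast; ring
    rw [h1, h2, h5]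
    linarith

theorem sum_one_div_sub_sq_le (k : ℕ) :
    ∑ i ∈ Finset.range (2 * k + 1), 1 / ((i : ℝ) - (k : ℝ)) ^ 2 ≤ 4 := by
  cases k with
  | zero => norm_num
  | succ k =>
    refine (sum_one_div_sub_sq_le_sub k).trans (sub_le_self _ (by positivity))

theorem alpha_sq : alpha ^ 2 = 3 * π ^ 2 / 32 := by
  have h2 : ((2 : ℝ) ^ (-(5 / 2) : ℝ)) ^ 2 = 1 / 32 := by
    rw [← Real.rpow_mul_natCast (by norm_num)]
    norm_num [Real.rpow_neg]
  have h3 : ((3 : ℝ) ^ (1 / 2 : ℝ)) ^ 2 = 3 := by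
    rw [← Real.rpow_mul_natCast (by norm_num)]
    norm_num
  rw [alpha, mul_pow, mul_pow, h2, h3]
  ring

theorem alpha_pos : 0 < alpha := by unfold alpha; positivity

/-- The right side is `3π⁴/(8n²)`, so the claim is `π⁴ ≥ 96`; `3.14⁴` already exceeds this. -/
theorem le_step_sq {n : ℕ} (hn : 0 < n) : 36 / (n : ℝ) ^ 2 ≤ (2 * π / (n : ℝ) * alpha) ^ 2 := by
  have hn' : (0 : ℝ) < n := by exact_mod_cast hn
  rw [mul_pow, div_pow, alpha_sq, div_mul_eq_mul_div]
  gcongr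
  have h : (3.14 : ℝ) ^ 4 ≤ π ^ 4 := by gcongr; exact Real.pi_gt_d2.le
  norm_num at h
  nlinarith

/-! ### Averaging the central difference -/

theorem centralDiff_two_mul (k : ℕ) (h : ℝ) (f : C(T, ℂ)) (x : T) :
    centralDiff (2 * k) h f x = ∑ i ∈ Finset.range (2 * k + 1),
      (-1 : ℂ) ^ (2 * k - i) * ((2 * k).choose i : ℂ) *
        f (x + (((((i : ℤ) - (k : ℤ) : ℤ) : ℝ) * h : ℝ) : T)) := by
  refine Finset.sum_congr rfl fun i _ => ?_
  congr 4
  push_cast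
  ring

theorem norm_centralDiff_le_modulus (m : ℕ) (f : C(T, ℂ)) {h δ : ℝ} (hh : |h| < δ) (x : T) :
    ‖centralDiff m h f x‖ ≤ modulus m f δ :=
  le_csSup (bddAbove_modulusSet m f δ) ⟨x, h, hh, rfl⟩

/-- Averaging the symmetric difference of even order against the triangular weight. -/
theorem integral_centralDiff (k : ℕ) (f : C(T, ℂ)) (δ : ℝ) (x : T) :
    ∫ h in (0 : ℝ)..δ, ((δ - h : ℝ) : ℂ) *
        (centralDiff (2 * k) h f x + centralDiff (2 * k) (-h) f x)
      = ∑ i ∈ Finset.range (2 * k + 1),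
        (-1 : ℂ) ^ (2 * k - i) * ((2 * k).choose i : ℂ) * hatAverage (i - k) δ x f := by
  simp only [hatAverage, ← intervalIntegral.integral_const_mul]
  rw [← intervalIntegral.integral_finsetSum fun i _ =>
    ((continuous_hatAverage_integrand _ δ x f).const_mul _).intervalIntegrable _ _]
  congr 1
  ext h
  rw [centralDiff_two_mul, centralDiff_two_mul, ← Finset.sum_add_distrib, Finset.mul_sum]
  refine Finset.sum_congr rfl fun i _ => ?_
  rw [mul_neg, AddCircle.coe_neg, ← sub_eq_add_neg]
  ring

theorem choose_mul_norm_apply_le (k : ℕ) {n : ℕ} (hn : 0 < n) {f : C(T, ℂ)}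
    (hf : f ∈ NoSpectrum n) {δ : ℝ} (hδ : 0 < δ) (x : T) :
    ((2 * k).choose k : ℝ) * (δ ^ 2 * ‖f x‖) ≤ δ ^ 2 * modulus (2 * k) f δ +
      (k / (k + 1) * (2 * k).choose k) * (36 / (n : ℝ) ^ 2 * ‖f‖) := by
  have hint := norm_integral_sub_mul_le hδ.le (C := 2 * modulus (2 * k) f δ)
    (u := fun h => centralDiff (2 * k) h f x + centralDiff (2 * k) (-h) f x) fun h h0 h1 => by
      refine (norm_add_le _ _).trans ((add_le_add ?_ ?_).trans_eq (two_mul _).symm)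
      · exact norm_centralDiff_le_modulus _ f (by rwa [abs_of_pos h0]) x
      · exact norm_centralDiff_le_modulus _ f (by rwa [abs_neg, abs_of_pos h0]) x
  rw [integral_centralDiff] at hint
  have hk : k ∈ Finset.range (2 * k + 1) := Finset.mem_range.mpr (by omega)
  rw [← Finset.add_sum_erase _ _ hk] at hint
  have hmain : ‖(-1 : ℂ) ^ (2 * k - k) * ((2 * k).choose k : ℂ) * hatAverage (k - k) δ x f‖
      = ((2 * k).choose k : ℝ) * (δ ^ 2 * ‖f x‖) := by
    rw [sub_self, hatAverage_zero]
    simp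
  have hrest : ‖∑ i ∈ (Finset.range (2 * k + 1)).erase k,
      (-1 : ℂ) ^ (2 * k - i) * ((2 * k).choose i : ℂ) * hatAverage (i - k) δ x f‖
      ≤ (k / (k + 1) * (2 * k).choose k) * (36 / (n : ℝ) ^ 2 * ‖f‖) := by
    calc _ ≤ ∑ i ∈ (Finset.range (2 * k + 1)).erase k, (k / (k + 1) * (2 * k).choose k : ℝ) *
          (9 / (n : ℝ) ^ 2 * ‖f‖ * (1 / ((i : ℝ) - k) ^ 2)) := by
          refine norm_sum_le_of_le _ fun i hi => ?_
          obtain ⟨hik, hir⟩ := Finset.mem_erase.mp hi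
          rw [Finset.mem_range] at hir
          rw [norm_mul, norm_mul, norm_pow, norm_neg, norm_one, one_pow, one_mul,
            Complex.norm_natCast]
          have h1 := norm_hatAverage_le hn hf (l := (i : ℤ) - k) (by omega) hδ.le x
          push_cast at h1
          have h2 : ((2 * k).choose i : ℝ) ≤ k / (k + 1) * (2 * k).choose k := by
            rw [div_mul_eq_mul_div, le_div_iff₀ (by positivity), mul_comm]
            exact_mod_cast choose_two_mul_le hik (by omega)
          exact mul_le_mul h2 h1 (norm_nonneg _) (by positivity)
      -- Restoring `i = k` costs nothing, its summand being `1/0 = 0`.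
      _ ≤ ∑ i ∈ Finset.range (2 * k + 1), (k / (k + 1) * (2 * k).choose k : ℝ) *
          (9 / (n : ℝ) ^ 2 * ‖f‖ * (1 / ((i : ℝ) - k) ^ 2)) :=
          Finset.sum_le_sum_of_subset_of_nonneg (Finset.erase_subset _ _)
            fun i _ _ => by positivity
      _ = (k / (k + 1) * (2 * k).choose k : ℝ) * (9 / (n : ℝ) ^ 2 * ‖f‖ *
          ∑ i ∈ Finset.range (2 * k + 1), 1 / ((i : ℝ) - k) ^ 2) := by
          rw [Finset.mul_sum, Finset.mul_sum]
      _ ≤ (k / (k + 1) * (2 * k).choose k : ℝ) * (9 / (n : ℝ) ^ 2 * ‖f‖ * 4) := by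
          gcongr
          exact sum_one_div_sub_sq_le k
      _ = _ := by ring
  have htri := norm_sub_norm_le
    ((-1 : ℂ) ^ (2 * k - k) * ((2 * k).choose k : ℂ) * hatAverage (k - k) δ x f)
    (-∑ i ∈ (Finset.range (2 * k + 1)).erase k,
      (-1 : ℂ) ^ (2 * k - i) * ((2 * k).choose i : ℂ) * hatAverage (i - k) δ x f)
  rw [norm_neg, sub_neg_eq_add, hmain] at htri
  linarith

end BohrFavard
end

/-! ### Conclusion -/

theorem theorem2 (k n : ℕ) (hn : 0 < n) (hnk : 2 * k ≤ n)
    (f : C(BohrFavard.T, ℂ)) (hf : f ∈ BohrFavard.NoSpectrum n) :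
    ‖f‖ ≤ ((k : ℝ) + 1) / ((2 * k).choose k : ℝ) *
      BohrFavard.modulus (2 * k) f (2 * π / (n : ℝ) * BohrFavard.alpha) := by
  have hn' : (0 : ℝ) < n := by exact_mod_cast hn
  set δ := 2 * π / (n : ℝ) * BohrFavard.alpha with hδ_def
  have hδ : 0 < δ := by have := BohrFavard.alpha_pos; positivity
  obtain ⟨x, -, hmax⟩ := isCompact_univ.exists_isMaxOn ⟨0, trivial⟩ f.continuous.norm.continuousOn
  have hx : ‖f x‖ = ‖f‖ := le_antisymm (f.norm_coe_le_norm x)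
    ((f.norm_le (norm_nonneg _)).mpr fun y => hmax (Set.mem_univ y))
  have h := BohrFavard.choose_mul_norm_apply_le k hn hf hδ x
  rw [hx] at h
  have hC : (0 : ℝ) < (2 * k).choose k := by exact_mod_cast Nat.choose_pos (by omega)
  have h1 : (k / (k + 1) * (2 * k).choose k : ℝ) * (36 / (n : ℝ) ^ 2 * ‖f‖)
      ≤ (k / (k + 1) * (2 * k).choose k : ℝ) * (δ ^ 2 * ‖f‖) := by
    gcongr
    exact BohrFavard.le_step_sq hn
  set C : ℝ := ((2 * k).choose k : ℝ)
  -- The surviving share is `1 - k/(k+1) = 1/(k+1)`.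
  have h2 : δ ^ 2 * (C / (k + 1) * ‖f‖) ≤ δ ^ 2 * BohrFavard.modulus (2 * k) f δ := by
    have : δ ^ 2 * (C / (k + 1) * ‖f‖) = C * (δ ^ 2 * ‖f‖) - k / (k + 1) * C * (δ ^ 2 * ‖f‖) := by
      field_simp
      ring
    linarith
  have h3 := le_of_mul_le_mul_left h2 (by positivity)
  rw [div_mul_eq_mul_div, le_div_iff₀ hC]
  rw [div_mul_eq_mul_div, div_le_iff₀ (by positivity)] at h3
  linarith
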